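/- Consider one-sided online bipartite matching: the offline vertices are known in advance, and the $n$ online vertices arrive one at a time, each together with the set of its neighbours among the offline vertices. On each arrival a deterministic online algorithm irrevocably either matches the new vertex to one of its still unmatched neighbours or rejects it, based on the data items and decisions so far. The size of an instance is its number $n$ of online vertices. For a function $b:\mathbb N\to\mathbb N$, an online algorithm with $b(n)$ bits of advice knows $n$ and, before the first arrival on an instance of size $n$, receives a binary string of length $b(n)$ chosen by an oracle that knows the whole instance. Its asymptotic approximation ratio is $$\liminf_{n\to\infty}\ \inf_{I}\ \frac{v(\mathbb A,I)}{v(I)},$$ where $I$ ranges over the instances of size $n$ with at least one edge, $v(\mathbb A,I)$ is the size of the matching produced and $v(I)$ is the size of a maximum matching of $I$. Theorem. If an online algorithm for bipartite matching with $b(n)$ bits of advice, which knows $n$ in advance, has asymptotic approximation ratio greater than $\tfrac12$, then $$b(n) > \log_2\log_2 n-\log_2\log_2\log_2 n\qquad\text{for all sufficiently large } n,$$ and in particular $b(n)=\Omega(\log\log n)$. -/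

import Mathlib

open Filter

namespace OnlineMatching

/-- An instance of one-sided online bipartite matching with `n` online vertices, arriving in the
order `0, …, n - 1`, and `m` offline vertices: the bipartite graph is given by the set of
neighbours of every online vertex. These `n` sets are the data items. -/
abbrev Instance (n m : ℕ) : Type := Fin n → Finset (Fin m)

/-- A matching of the bipartite graph `I`: a set of edges that are pairwise vertex-disjoint. -/
structure IsMatching {n m : ℕ} (I : Instance n m) (M : Finset (Fin n × Fin m)) : Prop where
  edge : ∀ e ∈ M, e.2 ∈ I e.1
  disjoint : ∀ e ∈ M, ∀ f ∈ M, e ≠ f → e.1 ≠ f.1 ∧ e.2 ≠ f.2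

open Classical in
/-- The optimal value of `I`: the maximum cardinality of a matching. -/
noncomputable def opt {n m : ℕ} (I : Instance n m) : ℕ :=
  (Finset.univ.filter (fun M : Finset (Fin n × Fin m) => IsMatching I M)).sup Finset.card

/-- What an online algorithm has seen and done so far: the data items already processed, in order
of arrival, each with the decision taken for it (`some v`: matched to the offline vertex `v`;
`none`: rejected). -/
abbrev History (m : ℕ) : Type := List (Finset (Fin m) × Option (Fin m))

/-- A deterministic online algorithm for bipartite matching on the offline side `Fin m`, known in
advance. It takes an irrevocable decision for each arriving data item, based on that item and all
earlier items and decisions; it may match the arriving vertex to one of its neighbours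
that is still unmatched, or reject it. -/
structure OnlineAlgorithm (m : ℕ) where
  decide : History m → Finset (Fin m) → Option (Fin m)
  decide_mem : ∀ h N v, decide h N = some v → v ∈ N
  decide_unmatched : ∀ h N v, decide h N = some v → ∀ p ∈ h, p.2 ≠ some v

namespace OnlineAlgorithm

/-- The history after the algorithm has processed the data items `ds` in order. -/
def history {m : ℕ} (A : OnlineAlgorithm m) (ds : List (Finset (Fin m))) : History m :=
  ds.foldl (fun h N => h ++ [(N, A.decide h N)]) []

/-- The decision of the algorithm for the online vertex `i` of the instance `I`. -/
def decision {n m : ℕ} (A : OnlineAlgorithm m) (I : Instance n m) (i : Fin n) :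
    Option (Fin m) :=
  A.decide (A.history ((List.ofFn I).take i)) (I i)

/-- The matching that the algorithm produces on `I`. -/
def matching {n m : ℕ} (A : OnlineAlgorithm m) (I : Instance n m) : Finset (Fin n × Fin m) :=
  Finset.univ.filter (fun e => A.decision I e.1 = some e.2)

end OnlineAlgorithm

/-- A (non-uniform) online algorithm with `b n` bits of advice on instances with `n` data items.
An oracle that sees the whole instance provides the advice string before the first data item
arrives; `alg n m s` is the online algorithm that is run when the advice string is `s`, so the
algorithm knows the number `n` of data items and the offline side in advance. -/
structure AdviceAlgorithm (b : ℕ → ℕ) where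
  oracle : ∀ n m : ℕ, Instance n m → (Fin (b n) → Bool)
  alg : ∀ n m : ℕ, (Fin (b n) → Bool) → OnlineAlgorithm m

namespace AdviceAlgorithm

/-- The size of the matching that the algorithm produces on `I` with the oracle's advice. -/
def value {b : ℕ → ℕ} (A : AdviceAlgorithm b) {n m : ℕ} (I : Instance n m) : ℕ :=
  ((A.alg n m (A.oracle n m I)).matching I).card

open scoped ENNReal in
/-- The infimum of `value / opt` over all instances with `n` data items (and any number of offline
vertices). Graphs without edges, for which the quotient would be `0 / 0`, are left out. -/
noncomputable def ratio {b : ℕ → ℕ} (A : AdviceAlgorithm b) (n : ℕ) : ℝ≥0∞ :=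
  ⨅ (m : ℕ) (I : Instance n m) (_ : 0 < opt I), (A.value I : ℝ≥0∞) / (opt I : ℝ≥0∞)

open scoped ENNReal in
/-- The asymptotic approximation ratio: `liminf` over the size `n` of the worst-case ratio. -/
noncomputable def asymptoticRatio {b : ℕ → ℕ} (A : AdviceAlgorithm b) : ℝ≥0∞ :=
  liminf (fun n : ℕ => A.ratio n) atTop

end AdviceAlgorithm

end OnlineMatching

/-! With `b` bits of advice, the oracle merely picks the best of `k = 2 ^ b` deterministic
algorithms. An adversary therefore defeats all of them at once: on one instance with `n` online and
`n` offline vertices each matches at most `n / 2`, yet some matching has size at least `n - (k + 1)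
^ k` (`exists_hard_instance`). A ratio above `1 / 2` then forces `(k + 1) ^ k ≥ δ n` for some `δ >
0`, hence the bound on `b`.

The adversary (`foolable`) recurses on the set `K` of algorithms that may still match into `D`. It
presents `t` copies of `D`; let `U` be the set of vertices newly taken by at least one algorithm. It
stops when `t + |U|` is just about `|D|`: the copies can be matched into `D \ U`, and `U` stays free
for later. Each vertex of `U` is exhausted for some algorithm, so splitting `U` by the set of
algorithms still active gives proper subsets of `K`, and the recursion treats each class. An
algorithm that took `S` in the first phase gets at most `|S| + (|U| - |S|) / 2 ≤ (t + |U|) / 2 ≤ |D|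
/ 2`. -/

namespace OnlineMatching

/-! ### Offline vertices consumed by a deterministic algorithm -/

namespace OnlineAlgorithm

variable {m : ℕ} (A : OnlineAlgorithm m)

theorem history_append_singleton (ds : List (Finset (Fin m))) (N : Finset (Fin m)) :
    A.history (ds ++ [N]) = A.history ds ++ [(N, A.decide (A.history ds) N)] := by
  simp [history]

/-- The offline vertices that are matched once the data items `ds` have been processed. -/
def used (ds : List (Finset (Fin m))) : Finset (Fin m) :=
  ((A.history ds).filterMap Prod.snd).toFinset

theorem used_nil : A.used [] = ∅ := by
  simp [used, history]

theorem used_append_singleton (ds : List (Finset (Fin m))) (N : Finset (Fin m)) :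
    A.used (ds ++ [N]) = A.used ds ∪ (A.decide (A.history ds) N).toFinset := by
  rw [used, history_append_singleton, List.filterMap_append, List.toFinset_append, used]
  congr 1
  cases A.decide (A.history ds) N <;> simp

theorem used_append_singleton_subset (ds : List (Finset (Fin m))) (N : Finset (Fin m)) :
    A.used (ds ++ [N]) ⊆ A.used ds ∪ N := by
  rw [used_append_singleton]
  refine Finset.union_subset_union_right fun v hv => ?_
  exact A.decide_mem _ _ _ (by simpa using hv)

theorem card_used_append_singleton_sdiff_le (ds : List (Finset (Fin m))) (N : Finset (Fin m)) :
    (A.used (ds ++ [N]) \ A.used ds).card ≤ 1 := by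
  rw [used_append_singleton, Finset.union_sdiff_left]
  refine (Finset.card_le_card Finset.sdiff_subset).trans ?_
  rw [Option.card_toFinset]
  cases A.decide (A.history ds) N <;> simp

theorem used_subset_append (ds es : List (Finset (Fin m))) :
    A.used ds ⊆ A.used (ds ++ es) := by
  induction es using List.reverseRecOn with
  | nil => simp
  | append_singleton es N ih =>
    rw [← List.append_assoc, used_append_singleton]
    exact ih.trans Finset.subset_union_left

theorem used_append_subset (ds es : List (Finset (Fin m))) (D : Finset (Fin m))
    (h : ∀ N ∈ es, N ⊆ D) : A.used (ds ++ es) ⊆ A.used ds ∪ D := by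
  induction es using List.reverseRecOn with
  | nil => simp
  | append_singleton es N ih =>
    rw [← List.append_assoc]
    refine (A.used_append_singleton_subset _ N).trans (Finset.union_subset ?_ ?_)
    · exact ih fun N' hN' => h N' (by simp [hN'])
    · exact (h N (by simp)).trans Finset.subset_union_right

theorem card_used_append_sdiff_le (ds es : List (Finset (Fin m))) :
    (A.used (ds ++ es) \ A.used ds).card ≤ es.length := by
  induction es using List.reverseRecOn with
  | nil => simp
  | append_singleton es N ih =>
    have h := A.card_used_append_singleton_sdiff_le (ds ++ es) N
    rw [← List.append_assoc]
    have hsub : A.used (ds ++ es ++ [N]) \ A.used ds ⊆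
        (A.used (ds ++ es ++ [N]) \ A.used (ds ++ es)) ∪ (A.used (ds ++ es) \ A.used ds) := by
      intro v
      simp only [Finset.mem_sdiff, Finset.mem_union]
      tauto
    have := (Finset.card_le_card hsub).trans (Finset.card_union_le _ _)
    simp only [List.length_append, List.length_singleton]
    omega

theorem notMem_used_of_decide {ds : List (Finset (Fin m))} {N : Finset (Fin m)} {v : Fin m}
    (h : A.decide (A.history ds) N = some v) : v ∉ A.used ds := by
  intro hv
  simp only [used, List.mem_toFinset, List.mem_filterMap] at hv
  obtain ⟨p, hp, hpv⟩ := hv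
  exact A.decide_unmatched _ _ _ h p hp hpv

theorem mem_used_take_of_decision {n : ℕ} {I : Instance n m} {i : Fin n} {v : Fin m}
    (h : A.decision I i = some v) {j : ℕ} (hj : (i : ℕ) < j) :
    v ∈ A.used ((List.ofFn I).take j) := by
  have h1 : v ∈ A.used ((List.ofFn I).take i ++ [I i]) := by
    rw [used_append_singleton]
    rw [decision] at h
    simp [h]
  have h2 : (List.ofFn I).take i ++ [I i] = (List.ofFn I).take (i + 1) := by
    rw [List.take_add_one]
    simp
  rw [h2] at h1
  have h3 : (List.ofFn I).take j =
      (List.ofFn I).take (i + 1) ++ ((List.ofFn I).drop (i + 1)).take (j - (i + 1)) := by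
    rw [← List.take_add]
    congr 1
    omega
  rw [h3]
  exact A.used_subset_append _ _ h1

theorem eq_of_decision_eq_some {n : ℕ} {I : Instance n m} {i j : Fin n} {v : Fin m}
    (hi : A.decision I i = some v) (hj : A.decision I j = some v) : i = j := by
  rcases lt_trichotomy i j with h | h | h
  · exact absurd (A.mem_used_take_of_decision hi h) (A.notMem_used_of_decide hj)
  · exact h
  · exact absurd (A.mem_used_take_of_decision hj h) (A.notMem_used_of_decide hi)

theorem card_matching_le {n : ℕ} (I : Instance n m) :
    (A.matching I).card ≤ (A.used (List.ofFn I)).card := by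
  refine Finset.card_le_card_of_injOn Prod.snd ?_ ?_
  · rintro ⟨i, v⟩ he
    have h : A.decision I i = some v := by simpa [matching] using he
    have := A.mem_used_take_of_decision h i.isLt
    rwa [List.take_of_length_le (by simp)] at this
  · rintro ⟨i, v⟩ he ⟨j, w⟩ hf hvw
    obtain rfl : v = w := hvw
    have hi : A.decision I i = some v := by simpa [matching] using he
    have hj : A.decision I j = some v := by simpa [matching] using hf
    rw [A.eq_of_decision_eq_some hi hj]

end OnlineAlgorithm

/-- The data items `es` are subsets of `D` and can all be matched at once. -/
def Matchable {m : ℕ} (es : List (Finset (Fin m))) (D : Finset (Fin m)) : Prop :=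
  (∀ N ∈ es, N ⊆ D) ∧
    ∃ vs : List (Fin m), vs.Nodup ∧ List.Forall₂ (fun v N => v ∈ N) vs es ∧ ∀ v ∈ vs, v ∈ D

theorem Matchable.nil {m : ℕ} (D : Finset (Fin m)) : Matchable [] D :=
  ⟨by simp, [], by simp⟩

theorem Matchable.append {m : ℕ} {es fs : List (Finset (Fin m))} {D F G : Finset (Fin m)}
    (h : Matchable es D) (h' : Matchable fs F) (hd : Disjoint D F) (hD : D ⊆ G) (hF : F ⊆ G) :
    Matchable (es ++ fs) G := by
  obtain ⟨h1, vs, h2, h3, h4⟩ := h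
  obtain ⟨h1', ws, h2', h3', h4'⟩ := h'
  refine ⟨fun N hN => ?_, vs ++ ws, ?_, List.rel_append h3 h3', fun v hv => ?_⟩
  · rcases List.mem_append.1 hN with hN | hN
    · exact (h1 N hN).trans hD
    · exact (h1' N hN).trans hF
  · refine List.Nodup.append h2 h2' fun v hv hv' => ?_
    exact Finset.disjoint_left.1 hd (h4 v hv) (h4' v hv')
  · rcases List.mem_append.1 hv with hv | hv
    · exact hD (h4 v hv)
    · exact hF (h4' v hv)

/-- The online vertices of the first phase are matched outside of `U`, the later ones in `U`. -/
theorem Matchable.replicate_append {m t : ℕ} {es : List (Finset (Fin m))} {D U : Finset (Fin m)}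
    (hU : U ⊆ D) (ht : U.card + t ≤ D.card) (h : Matchable es U) :
    Matchable (List.replicate t D ++ es) D := by
  obtain ⟨h1, vs, h2, h3, h4⟩ := h
  have hc : t ≤ (D \ U).card := by
    rw [Finset.card_sdiff_of_subset hU]
    omega
  obtain ⟨S, hS, hSt⟩ := Finset.exists_subset_card_eq hc
  have hSD : ∀ v ∈ S, v ∈ D ∧ v ∉ U := fun v hv => Finset.mem_sdiff.1 (hS hv)
  refine ⟨fun N hN => ?_, S.toList ++ vs, ?_, List.rel_append ?_ h3, fun v hv => ?_⟩
  · rcases List.mem_append.1 hN with hN | hN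
    · rw [List.eq_of_mem_replicate hN]
    · exact (h1 N hN).trans hU
  · refine List.Nodup.append S.nodup_toList h2 fun v hv hv' => ?_
    exact (hSD v (Finset.mem_toList.1 hv)).2 (h4 v hv')
  · rw [List.forall₂_iff_get]
    refine ⟨by simp [hSt], fun i hi _ => ?_⟩
    have : S.toList.get ⟨i, hi⟩ ∈ S := Finset.mem_toList.1 (List.get_mem _ _)
    simpa using (hSD _ this).1
  · rcases List.mem_append.1 hv with hv | hv
    · exact (hSD v (Finset.mem_toList.1 hv)).1
    · exact hU (h4 v hv)

/-! ### The adversary against finitely many algorithms -/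

variable {ι : Type*} {m : ℕ}

/-- The vertices that the algorithms in `K` match when `t` copies of `D` arrive after `ds`. -/
def newlyUsed (A : ι → OnlineAlgorithm m) (K : Finset ι) (ds : List (Finset (Fin m)))
    (D : Finset (Fin m)) (t : ℕ) : Finset (Fin m) :=
  K.biUnion fun i => (A i).used (ds ++ List.replicate t D) \ (A i).used ds

theorem newlyUsed_subset (A : ι → OnlineAlgorithm m) (K : Finset ι)
    (ds : List (Finset (Fin m))) (D : Finset (Fin m)) (t : ℕ) : newlyUsed A K ds D t ⊆ D := by
  refine Finset.biUnion_subset.2 fun i _ v hv => ?_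
  rw [Finset.mem_sdiff] at hv
  have := (A i).used_append_subset ds (List.replicate t D) D
    (fun N hN => by rw [List.eq_of_mem_replicate hN]) hv.1
  exact (Finset.mem_union.1 this).resolve_left hv.2

theorem card_newlyUsed_succ_le (A : ι → OnlineAlgorithm m) (K : Finset ι)
    (ds : List (Finset (Fin m))) (D : Finset (Fin m)) (t : ℕ) :
    (newlyUsed A K ds D (t + 1)).card ≤ (newlyUsed A K ds D t).card + K.card := by
  have hsub : newlyUsed A K ds D (t + 1) ⊆ newlyUsed A K ds D t ∪
      K.biUnion fun i => (A i).used (ds ++ List.replicate t D ++ [D]) \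
        (A i).used (ds ++ List.replicate t D) := by
    intro v
    simp only [newlyUsed, List.replicate_succ', ← List.append_assoc, Finset.mem_union,
      Finset.mem_biUnion, Finset.mem_sdiff]
    rintro ⟨i, hi, h, h'⟩
    by_cases hv : v ∈ (A i).used (ds ++ List.replicate t D)
    · exact Or.inl ⟨i, hi, hv, h'⟩
    · exact Or.inr ⟨i, hi, h, hv⟩
  refine (Finset.card_le_card hsub).trans ((Finset.card_union_le _ _).trans ?_)
  refine Nat.add_le_add_left ?_ _
  simpa using Finset.card_biUnion_le_card_mul K _ 1
    fun i _ => (A i).card_used_append_singleton_sdiff_le (ds ++ List.replicate t D) D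

/-- One more copy of `D` raises `|U| + t` by at most `|K| + 1`, so the last `t` at which this sum
does not exceed `|D|` falls short of it by at most `|K|`. -/
theorem exists_length_first_phase (A : ι → OnlineAlgorithm m) (K : Finset ι)
    (ds : List (Finset (Fin m))) (D : Finset (Fin m)) :
    ∃ t, (newlyUsed A K ds D t).card + t ≤ D.card ∧
      D.card ≤ (newlyUsed A K ds D t).card + t + K.card := by
  classical
  let P : ℕ → Prop := fun t => (newlyUsed A K ds D t).card + t ≤ D.card
  have h0 : P 0 := by
    have : newlyUsed A K ds D 0 = ∅ := by
      ext v
      simp [newlyUsed]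
    simp [P, this]
  obtain ⟨t, ht⟩ : ∃ t, t = Nat.findGreatest P D.card := ⟨_, rfl⟩
  have hP : P t := ht ▸ Nat.findGreatest_spec (Nat.zero_le _) h0
  have hsucc : ¬ P (t + 1) := by
    intro h
    have h' : t + 1 ≤ D.card := by
      simp only [P] at h
      omega
    have := Nat.le_findGreatest h' h
    omega
  have := card_newlyUsed_succ_le A K ds D t
  simp only [P] at hP hsucc
  exact ⟨t, hP, by omega⟩

variable [DecidableEq ι]

/-- If no algorithm outside of `K` can match a vertex of `D` any more, then the adversary can
continue with data items that admit a matching of almost all of `D`, whereas no algorithm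
matches more than half of `D`. -/
def Foolable (A : ι → OnlineAlgorithm m) (K : Finset ι) : Prop :=
  ∀ (ds : List (Finset (Fin m))) (D : Finset (Fin m)),
    (∀ i ∉ K, D ⊆ (A i).used ds) →
    ∃ es : List (Finset (Fin m)), Matchable es D ∧
      D.card ≤ es.length + (K.card + 1) ^ K.card ∧
      ∀ i ∈ K, 2 * ((A i).used (ds ++ es)).card ≤ 2 * ((A i).used ds).card + D.card

/-- The adversary can treat the classes of vertices with the same active algorithms `c v` one after
the other. -/
theorem exists_continuation_of_foolable (A : ι → OnlineAlgorithm m) (𝒦 : Finset (Finset ι))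
    (h𝒦 : ∀ K ∈ 𝒦, Foolable A K) (ds : List (Finset (Fin m))) (D : Finset (Fin m))
    (c : Fin m → Finset ι) (hc : ∀ v ∈ D, ∀ i ∉ c v, v ∈ (A i).used ds) :
    ∃ es : List (Finset (Fin m)), Matchable es {v ∈ D | c v ∈ 𝒦} ∧
      ({v ∈ D | c v ∈ 𝒦} : Finset (Fin m)).card ≤
        es.length + ∑ K ∈ 𝒦, (K.card + 1) ^ K.card ∧
      ∀ i, 2 * ((A i).used (ds ++ es)).card ≤
        2 * ((A i).used ds).card + ({v ∈ D | c v ∈ 𝒦 ∧ i ∈ c v} : Finset (Fin m)).card := by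
  classical
  induction 𝒦 using Finset.induction_on with
  | empty => exact ⟨[], Matchable.nil _, by simp, by simp⟩
  | insert K 𝒦 hK ih =>
    obtain ⟨es, h1, h2, h3⟩ := ih fun K' hK' => h𝒦 K' (Finset.mem_insert_of_mem hK')
    have hfull : ∀ i ∉ K, ({v ∈ D | c v = K} : Finset (Fin m)) ⊆ (A i).used (ds ++ es) := by
      intro i hi v hv
      rw [Finset.mem_filter] at hv
      exact (A i).used_subset_append _ _ (hc v hv.1 i (hv.2 ▸ hi))
    obtain ⟨fs, h1', h2', h3'⟩ :=
      h𝒦 K (Finset.mem_insert_self _ _) (ds ++ es) {v ∈ D | c v = K} hfull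
    have hdisj : Disjoint ({v ∈ D | c v ∈ 𝒦} : Finset (Fin m)) {v ∈ D | c v = K} := by
      rw [Finset.disjoint_left]
      intro v hv hv'
      rw [Finset.mem_filter] at hv hv'
      exact hK (hv'.2 ▸ hv.2)
    have hunion : ({v ∈ D | c v ∈ insert K 𝒦} : Finset (Fin m)) =
        {v ∈ D | c v ∈ 𝒦} ∪ {v ∈ D | c v = K} := by
      ext v
      simp only [Finset.mem_filter, Finset.mem_union, Finset.mem_insert]
      tauto
    refine ⟨es ++ fs, ?_, ?_, fun i => ?_⟩
    · rw [hunion]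
      exact h1.append h1' hdisj Finset.subset_union_left Finset.subset_union_right
    · rw [hunion, Finset.card_union_of_disjoint hdisj, Finset.sum_insert hK, List.length_append]
      omega
    · rw [← List.append_assoc]
      have hi := h3 i
      by_cases hiK : i ∈ K
      · have hi' := h3' i hiK
        have : ({v ∈ D | c v ∈ insert K 𝒦 ∧ i ∈ c v} : Finset (Fin m)) =
            {v ∈ D | c v ∈ 𝒦 ∧ i ∈ c v} ∪ {v ∈ D | c v = K} := by
          ext v
          simp only [Finset.mem_filter, Finset.mem_union, Finset.mem_insert]
          constructor
          · tauto
          · rintro (h | ⟨h, h'⟩)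
            · tauto
            · exact ⟨h, Or.inl h', h' ▸ hiK⟩
        rw [this, Finset.card_union_of_disjoint]
        · omega
        · refine hdisj.mono_left fun v => ?_
          simp only [Finset.mem_filter]
          tauto
      -- An algorithm outside `K` has already used the whole class of `K`, so it gains nothing while
      -- that class is treated.
      · have hsub : (A i).used (ds ++ es ++ fs) ⊆ (A i).used (ds ++ es) :=
          ((A i).used_append_subset _ _ _ h1'.1).trans
            (Finset.union_subset subset_rfl (hfull i hiK))
        have hle := Finset.card_le_card hsub
        have hle' : ({v ∈ D | c v ∈ 𝒦 ∧ i ∈ c v} : Finset (Fin m)).card ≤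
            ({v ∈ D | c v ∈ insert K 𝒦 ∧ i ∈ c v} : Finset (Fin m)).card := by
          refine Finset.card_le_card fun v => ?_
          simp only [Finset.mem_filter, Finset.mem_insert]
          tauto
        omega

/-- The recursion for the loss: `|K|` from stopping the first phase early, plus the losses of all
classes. Since `|L| + 1 ≤ |K|` for proper subsets, the binomial theorem bounds the sum by `(|K| + 1)
^ |K| - |K| ^ |K|`, and the missing term pays for `|K|`. -/
theorem card_add_sum_ssubsets_le (K : Finset ι) :
    K.card + ∑ L ∈ K.ssubsets, (L.card + 1) ^ L.card ≤ (K.card + 1) ^ K.card := by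
  have h1 : ∑ L ∈ K.ssubsets, (L.card + 1) ^ L.card ≤ ∑ L ∈ K.ssubsets, K.card ^ L.card := by
    refine Finset.sum_le_sum fun L hL => Nat.pow_le_pow_left ?_ _
    exact Finset.card_lt_card (Finset.mem_ssubsets.1 hL)
  have h2 : ∑ L ∈ K.ssubsets, K.card ^ L.card + K.card ^ K.card = (K.card + 1) ^ K.card := by
    have h := Finset.sum_pow_mul_eq_add_pow K.card 1 K
    simp only [one_pow, mul_one] at h
    rw [← h, Finset.ssubsets]
    exact Finset.sum_erase_add _ (f := fun L => K.card ^ L.card) (Finset.mem_powerset_self K)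
  have h3 : K.card ≤ K.card ^ K.card := by
    rcases Nat.eq_zero_or_pos K.card with h | h
    · simp [h]
    · exact Nat.le_self_pow h.ne' _
  omega

theorem foolable (A : ι → OnlineAlgorithm m) (K : Finset ι) : Foolable A K := by
  induction K using Finset.strongInduction with
  | H K ih =>
  intro ds D hD
  obtain ⟨t, ht1, ht2⟩ := exists_length_first_phase A K ds D
  set U := newlyUsed A K ds D t with hU
  set ds' := ds ++ List.replicate t D with hds'
  -- The algorithms of `K` that did not take `v` in the first phase; for `v ∈ U` at least one did,
  -- so `c v` is a proper subset.
  let c : Fin m → Finset ι := fun v => {i ∈ K | v ∉ (A i).used ds' \ (A i).used ds}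
  have hUD : U ⊆ D := newlyUsed_subset A K ds D t
  have hcU : ∀ v ∈ U, c v ∈ K.ssubsets := by
    intro v hv
    obtain ⟨i, hi, hvi⟩ := Finset.mem_biUnion.1 hv
    exact Finset.mem_ssubsets.2 (Finset.filter_ssubset.2 ⟨i, hi, not_not.2 hvi⟩)
  have hc : ∀ v ∈ U, ∀ i ∉ c v, v ∈ (A i).used ds' := by
    intro v hv i hi
    by_cases hiK : i ∈ K
    · by_contra hv'
      exact hi (Finset.mem_filter.2 ⟨hiK, fun h => hv' (Finset.mem_sdiff.1 h).1⟩)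
    · exact (A i).used_subset_append _ _ (hD i hiK (hUD hv))
  obtain ⟨es, h1, h2, h3⟩ := exists_continuation_of_foolable A K.ssubsets
    (fun L hL => ih L (Finset.mem_ssubsets.1 hL)) ds' U c hc
  rw [Finset.filter_true_of_mem hcU] at h1 h2
  refine ⟨List.replicate t D ++ es, h1.replicate_append hUD ht1, ?_, fun i hi => ?_⟩
  · have := card_add_sum_ssubsets_le K
    rw [List.length_append, List.length_replicate]
    omega
  · have h := h3 i
    set S := (A i).used ds' \ (A i).used ds with hS
    have hSU : S ⊆ U := Finset.subset_biUnion_of_mem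
      (fun i => (A i).used (ds ++ List.replicate t D) \ (A i).used ds) hi
    -- Only classes containing `i` can profit algorithm `i`, and these avoid the set `S` that it
    -- took in the first phase.
    have hfilter : ({v ∈ U | c v ∈ K.ssubsets ∧ i ∈ c v} : Finset (Fin m)) ⊆ U \ S := by
      intro v hv
      rw [Finset.mem_filter] at hv
      exact Finset.mem_sdiff.2 ⟨hv.1, (Finset.mem_filter.1 hv.2.2).2⟩
    have h4 := Finset.card_le_card hfilter
    rw [Finset.card_sdiff_of_subset hSU] at h4
    have h5 : S.card ≤ t := by
      simpa using (A i).card_used_append_sdiff_le ds (List.replicate t D)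
    have h6 : S.card + ((A i).used ds).card = ((A i).used ds').card :=
      Finset.card_sdiff_add_card_eq_card ((A i).used_subset_append _ _)
    have h7 := Finset.card_le_card hSU
    rw [← List.append_assoc, ← hds']
    omega

/-! ### From the adversary to a single hard instance -/

theorem card_le_opt {n m : ℕ} {I : Instance n m} {M : Finset (Fin n × Fin m)}
    (hM : IsMatching I M) : M.card ≤ opt I := by
  classical
  exact Finset.le_sup (f := Finset.card) (Finset.mem_filter.2 ⟨Finset.mem_univ _, hM⟩)

theorem Matchable.length_le_opt {n m : ℕ} {es : List (Finset (Fin m))} {D : Finset (Fin m)}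
    (h : Matchable es D) (hn : es.length ≤ n) :
    es.length ≤ opt (fun j : Fin n => es.getD j ∅) := by
  obtain ⟨-, vs, hvs, hmem, -⟩ := h
  obtain ⟨hlen, hmem⟩ := List.forall₂_iff_get.1 hmem
  have hinj : Function.Injective
      (fun j : Fin es.length =>
      ((⟨j, j.2.trans_le hn⟩, vs.get (j.cast hlen.symm)) : Fin n × Fin m)) := by
    intro i j hij
    simpa [Fin.ext_iff] using congrArg Prod.fst hij
  have hM : IsMatching (fun j : Fin n => es.getD j ∅) (Finset.univ.map ⟨_, hinj⟩) := by
    constructor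
    · intro e he
      obtain ⟨j, -, rfl⟩ := Finset.mem_map.1 he
      have := hmem j (hlen.symm ▸ j.2) j.2
      simpa using this
    · intro e he f hf hef
      obtain ⟨i, -, rfl⟩ := Finset.mem_map.1 he
      obtain ⟨j, -, rfl⟩ := Finset.mem_map.1 hf
      have hij : (i : ℕ) ≠ j := fun h => hef (by rw [Fin.ext h])
      refine ⟨fun h => hij (by simpa using h), fun h => hij ?_⟩
      have := (List.Nodup.get_inj_iff hvs).1 h
      simpa [Fin.ext_iff] using this
  simpa using card_le_opt hM

/-- On some instance with `n` data items, each of the finitely many algorithms matches at most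
`n / 2` vertices, although there is an almost perfect matching. -/
theorem exists_hard_instance [Fintype ι] (n : ℕ) (A : ι → OnlineAlgorithm n) :
    ∃ I : Instance n n, n ≤ opt I + (Fintype.card ι + 1) ^ Fintype.card ι ∧
      ∀ i, 2 * ((A i).matching I).card ≤ n := by
  obtain ⟨es, h1, h2, h3⟩ := foolable A Finset.univ [] Finset.univ (by simp)
  have hlen : es.length ≤ n := by
    obtain ⟨-, vs, hvs, hmem, -⟩ := h1
    rw [← hmem.length_eq]
    simpa using hvs.length_le_card
  refine ⟨fun j => es.getD j ∅, ?_, fun i => ?_⟩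
  · have := h1.length_le_opt hlen
    simp only [Finset.card_univ, Fintype.card_fin] at h2
    omega
  -- The default value `∅` pads the instance to `n` online vertices with isolated ones, which no
  -- algorithm can match.
  · have hlist : List.ofFn (fun j : Fin n => es.getD j ∅) =
        [] ++ es ++ List.replicate (n - es.length) ∅ := by
      refine List.ext_getElem (by simp; omega) fun j hj hj' => ?_
      simp only [List.getElem_ofFn, List.nil_append, List.getElem_append, List.getElem_replicate]
      split_ifs with h
      · simp [h]
      · simp [not_lt.1 h]
    have hsub := (A i).used_append_subset ([] ++ es) (List.replicate (n - es.length) ∅) ∅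
      (fun N hN => by rw [List.eq_of_mem_replicate hN])
    rw [← hlist, Finset.union_empty] at hsub
    have h4 := (A i).card_matching_le (fun j : Fin n => es.getD j ∅)
    have h5 := Finset.card_le_card hsub
    have h6 := h3 i (Finset.mem_univ i)
    rw [OnlineAlgorithm.used_nil] at h6
    simp only [Finset.card_empty, Finset.card_univ, Fintype.card_fin] at h6
    omega

end OnlineMatching

/-! ### Estimates for iterated logarithms -/

theorem one_add_le_two_rpow {x : ℝ} (hx : 1 ≤ x) : 1 + x ≤ 2 ^ x := by
  have := one_add_mul_self_le_rpow_one_add (s := (1 : ℝ)) (by norm_num) hx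
  norm_num at this
  linarith

theorem logb_one_add_le {x : ℝ} (hx : 1 ≤ x) : Real.logb 2 (1 + x) ≤ x := by
  rw [Real.logb_le_iff_le_rpow one_lt_two (by linarith)]
  exact one_add_le_two_rpow hx

theorem logb_le_self {x : ℝ} (hx : 1 ≤ x) : Real.logb 2 x ≤ x :=
  (Real.logb_le_logb_of_le one_lt_two (by linarith) (by linarith)).trans (logb_one_add_le hx)

/-- Comparing at `x / 4` gives `log x ≤ 2 + x / 4`, and this is at most `x / 2` once `x ≥ 8`. -/
theorem logb_le_half {x : ℝ} (hx : 8 ≤ x) : Real.logb 2 x ≤ x / 2 := by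
  have h1 : Real.logb 2 (x / 4) ≤ x / 4 := logb_le_self (by linarith)
  have h2 : Real.logb 2 4 = 2 := by
    rw [show (4 : ℝ) = 2 ^ (2 : ℝ) by norm_num, Real.logb_rpow two_pos (by norm_num)]
  rw [Real.logb_div (by linarith) (by norm_num), h2] at h1
  linarith

theorem tendsto_logb_logb_atTop :
    Tendsto (fun n : ℕ => Real.logb 2 (Real.logb 2 (n : ℝ))) atTop atTop :=
  (Real.tendsto_logb_atTop one_lt_two).comp
    ((Real.tendsto_logb_atTop one_lt_two).comp tendsto_natCast_atTop_atTop)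

/-- If `k = 2 ^ b` with `b ≤ log log n - log log log n`, then `(k + 1) ^ k = o(n)`. -/
theorem eventually_two_pow_add_one_pow_lt {δ : ℝ} (hδ : 0 < δ) :
    ∀ᶠ n : ℕ in atTop, ∀ b : ℕ,
      (b : ℝ) ≤ Real.logb 2 (Real.logb 2 n) - Real.logb 2 (Real.logb 2 (Real.logb 2 n)) →
      ((2 : ℝ) ^ b + 1) ^ 2 ^ b < δ * n := by
  have hlog := (Real.tendsto_logb_atTop one_lt_two).comp tendsto_logb_logb_atTop
  filter_upwards [hlog.eventually_ge_atTop 1, hlog.eventually_gt_atTop (1 - Real.logb 2 δ),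
    tendsto_logb_logb_atTop.eventually_ge_atTop 1,
    ((Real.tendsto_logb_atTop one_lt_two).comp
      tendsto_natCast_atTop_atTop).eventually_ge_atTop 1,
    eventually_gt_atTop 0] with n h1 h2 h3 h4 hn b hb
  simp only [Function.comp_apply] at h1 h2 h4
  have hn' : (0 : ℝ) < n := by exact_mod_cast hn
  set L := Real.logb 2 (n : ℝ)
  set l := Real.logb 2 L
  set w := Real.logb 2 l
  have hlL : l ≤ L := logb_le_self h4
  have hk : (2 : ℝ) ^ b ≤ L / l := by
    rw [← Real.rpow_natCast]
    refine (Real.rpow_le_rpow_of_exponent_le one_le_two hb).trans_eq ?_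
    rw [Real.rpow_sub two_pos, Real.rpow_logb two_pos (by norm_num) (by linarith),
      Real.rpow_logb two_pos (by norm_num) (by linarith)]
  have hk1 : (1 : ℝ) ≤ 2 ^ b := one_le_pow₀ one_le_two
  have hbase : Real.logb 2 ((2 : ℝ) ^ b + 1) ≤ 1 + b := by
    rw [Real.logb_le_iff_le_rpow one_lt_two (by linarith), Real.rpow_add two_pos, Real.rpow_one,
      Real.rpow_natCast]
    linarith
  have hw : w ≤ l := logb_le_self h3
  have hLl : 1 ≤ L / l := (one_le_div (by linarith)).2 hlL
  -- The left side bounds `log ((k + 1) ^ k)`. The right side equals `L - (L / l) (w - 1) ≤ L - (w -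
  -- 1)`, which is below `log (δ n) = L + log δ` because `w > 1 - log δ`.
  have hmul : (2 : ℝ) ^ b * (1 + b) ≤ L / l * (l - (w - 1)) := by
    gcongr
    linarith
  have hexp : L / l * (l - (w - 1)) = L - L / l * (w - 1) := by
    have : l ≠ 0 := by linarith
    field_simp
  have hge : w - 1 ≤ L / l * (w - 1) := le_mul_of_one_le_left (by linarith) hLl
  rw [← Real.logb_lt_logb_iff one_lt_two (by positivity) (by positivity), Real.logb_pow,
    Real.logb_mul hδ.ne' hn'.ne']
  push_cast
  calc (2 : ℝ) ^ b * Real.logb 2 ((2 : ℝ) ^ b + 1) ≤ 2 ^ b * (1 + b) := by gcongr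
    _ < Real.logb 2 δ + L := by linarith

/-! ### The lower bound on the advice -/

theorem OnlineMatching.AdviceAlgorithm.exists_eventually_le_pow {b : ℕ → ℕ}
    (A : OnlineMatching.AdviceAlgorithm b) (hA : 1 / 2 < A.asymptoticRatio) :
    ∃ δ : ℝ, 0 < δ ∧ ∀ᶠ n : ℕ in atTop, δ * n ≤ ((2 : ℝ) ^ b n + 1) ^ 2 ^ b n := by
  obtain ⟨c, hc1, hc2⟩ := ENNReal.lt_iff_exists_nnreal_btwn.1 hA
  have hc : (1 : ℝ) / 2 < c := by
    have : ((1 / 2 : NNReal) : ENNReal) < c := by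
      rwa [ENNReal.coe_div two_ne_zero]
    exact_mod_cast ENNReal.coe_lt_coe.1 this
  -- A ratio of at least `c > 1 / 2` and a value of at most `n / 2` give `opt I ≤ n / (2 c)`; what
  -- remains of `n` must be covered by the loss `(k + 1) ^ k`.
  refine ⟨1 - 1 / (2 * c), ?_, ?_⟩
  · have : 1 / (2 * (c : ℝ)) < 1 := by
      rw [div_lt_one (by linarith)]
      linarith
    linarith
  filter_upwards [eventually_lt_of_lt_liminf hc2] with n hn
  obtain ⟨I, hI, hval⟩ := OnlineMatching.exists_hard_instance n (A.alg n n)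
  simp only [Fintype.card_pi, Fintype.card_bool, Finset.prod_const, Finset.card_univ,
    Fintype.card_fin] at hI
  have hI' : (n : ℝ) ≤ OnlineMatching.opt I + ((2 : ℝ) ^ b n + 1) ^ 2 ^ b n := by
    exact_mod_cast hI
  have hval' : 2 * (A.value I : ℝ) ≤ n := by
    exact_mod_cast hval (A.oracle n n I)
  have hopt : c * (OnlineMatching.opt I : ℝ) ≤ A.value I := by
    rcases Nat.eq_zero_or_pos (OnlineMatching.opt I) with h0 | h0
    · simp [h0]
    · have h : (c : ENNReal) ≤ A.value I / OnlineMatching.opt I :=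
        hn.le.trans (iInf_le_of_le n (iInf_le_of_le I (iInf_le _ h0)))
      rw [ENNReal.le_div_iff_mul_le (by simp [h0.ne']) (by simp)] at h
      exact_mod_cast h
  have hopt' : (OnlineMatching.opt I : ℝ) ≤ 1 / (2 * c) * n := by
    rw [div_mul_eq_mul_div, le_div_iff₀ (by linarith)]
    linarith
  linarith

theorem mainTheorem6 (b : ℕ → ℕ) (A : OnlineMatching.AdviceAlgorithm b)
    (hA : 1 / 2 < A.asymptoticRatio) :
    (∀ᶠ n : ℕ in Filter.atTop,
      Real.logb 2 (Real.logb 2 (n : ℝ)) - Real.logb 2 (Real.logb 2 (Real.logb 2 (n : ℝ)))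
        < (b n : ℝ)) ∧
    (fun n : ℕ => Real.logb 2 (Real.logb 2 (n : ℝ))) =O[Filter.atTop] (fun n : ℕ => (b n : ℝ)) := by
  obtain ⟨δ, hδ, hpow⟩ := A.exists_eventually_le_pow hA
  have hlt : ∀ᶠ n : ℕ in Filter.atTop,
      Real.logb 2 (Real.logb 2 (n : ℝ)) - Real.logb 2 (Real.logb 2 (Real.logb 2 (n : ℝ)))
        < (b n : ℝ) := by
    filter_upwards [hpow, eventually_two_pow_add_one_pow_lt hδ] with n h1 h2
    exact lt_of_not_ge fun h => (h2 (b n) h).not_ge h1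
  -- The triple logarithm is eventually at most half of the double one, hence the constant 2.
  refine ⟨hlt, Asymptotics.IsBigO.of_bound 2 ?_⟩
  filter_upwards [hlt, tendsto_logb_logb_atTop.eventually_ge_atTop 8] with n h1 h2
  have h3 := logb_le_half h2
  rw [Real.norm_of_nonneg (by linarith), Real.norm_of_nonneg (Nat.cast_nonneg _)]
  linarith
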